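/- **Theorem.** Let $f_1,\dots,f_m:\mathbb{R}^n\to\mathbb{R}$ be bounded below, convex and continuously differentiable with $L$-Lipschitz gradients for some $L\ge 0$, and suppose that for some $j_0\in\{1,\dots,m\}$ every sublevel set $\{z : f_{j_0}(z)\le c\}$, $c\in\mathbb{R}$, is bounded. For $x\in\mathbb{R}^n$ let $C(x)=\operatorname{conv}\{\nabla f_1(x),\dots,\nabla f_m(x)\}$, and let $\operatorname{proj}_K(0)$ denote the element of least norm of a nonempty closed convex set $K$. Let $\alpha>\beta>3$, $p>1$, $t_0\ge 1$ and $x_0,v_0\in\mathbb{R}^n$. Let $x:[t_0,\infty)\to\mathbb{R}^n$ be a bounded solution of the Cauchy problem $$\text{(CP)}\qquad \frac{\alpha}{t}\,\dot x(t)+\operatorname{proj}_{C(x(t))+r(t,x(t),\dot x(t))+\ddot x(t)}(0)=0,\qquad x(t_0)=x_0,\quad \dot x(t_0)=v_0,$$ $$r(t,x,v)=\frac{\alpha-\beta}{t^p}\,\frac{\|v\|}{\|\operatorname{proj}_{C(x)}(0)\|}\,\operatorname{proj}_{C(x)}(0)\qquad(\text{with } r(t,x,v)=0 \text{ if } \operatorname{proj}_{C(x)}(0)=0);$$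 here a solution is a $C^1$ function $x$ whose derivative $\dot x$ is absolutely continuous on compact subintervals of $[t_0,\infty)$, which satisfies the initial conditions, and the differential equation for almost every $t\ge t_0$. Then $x(t)$ converges, as $t\to\infty$, to a weak Pareto point of $\min_x (f_1(x),\dots,f_m(x))$, that is, to a point $x^\infty$ for which there is no $y\in\mathbb{R}^n$ with $f_i(y)<f_i(x^\infty)$ for all $i=1,\dots,m$. -/

import Mathlib

open Set Filter Topology MeasureTheory

namespace MultiobjFlow

/-- The metric projection of `u` onto `K`: the point of `K` nearest to `u`.  It exists and is unique
when `K` is nonempty, closed and convex, see `proj_spec` and `proj_eq`. -/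
noncomputable def proj {n : ℕ} (K : Set (EuclideanSpace ℝ (Fin n)))
    (u : EuclideanSpace ℝ (Fin n)) : EuclideanSpace ℝ (Fin n) :=
  Classical.epsilon fun y => y ∈ K ∧ ∀ z ∈ K, ‖y - u‖ ≤ ‖z - u‖

theorem proj_spec {n : ℕ} {K : Set (EuclideanSpace ℝ (Fin n))} (hne : K.Nonempty)
    (hcl : IsClosed K) (u : EuclideanSpace ℝ (Fin n)) :
    proj K u ∈ K ∧ ∀ z ∈ K, ‖proj K u - u‖ ≤ ‖z - u‖ := by
  obtain ⟨y, hy, hd⟩ := hcl.exists_infDist_eq_dist hne u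
  refine Classical.epsilon_spec
    (p := fun y => y ∈ K ∧ ∀ z ∈ K, ‖y - u‖ ≤ ‖z - u‖) ⟨y, hy, fun z hz => ?_⟩
  have h := Metric.infDist_le_dist_of_mem (x := u) hz
  rw [hd] at h
  rwa [← dist_eq_norm, ← dist_eq_norm, dist_comm y, dist_comm z]

theorem proj_eq {n : ℕ} {K : Set (EuclideanSpace ℝ (Fin n))} (hcl : IsClosed K)
    (hconv : Convex ℝ K) {u y : EuclideanSpace ℝ (Fin n)} (hy : y ∈ K)
    (hmin : ∀ z ∈ K, ‖y - u‖ ≤ ‖z - u‖) : proj K u = y := by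
  obtain ⟨h1, h2⟩ := proj_spec ⟨y, hy⟩ hcl u
  by_contra hne
  have hmid := hmin _ (hconv h1 hy (a := 1 / 2) (b := 1 / 2) (by norm_num) (by norm_num)
    (by norm_num))
  have heq : ‖proj K u - u‖ = ‖y - u‖ := le_antisymm (h2 y hy) (hmin _ h1)
  have hpar := parallelogram_law_with_norm ℝ (proj K u - u) (y - u)
  have e1 : (1 / 2 : ℝ) • proj K u + (1 / 2 : ℝ) • y - u
      = (1 / 2 : ℝ) • ((proj K u - u) + (y - u)) := by module
  have e2 : (proj K u - u) - (y - u) = proj K u - y := by abel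
  rw [e1, norm_smul, Real.norm_of_nonneg (by norm_num : (0 : ℝ) ≤ 1 / 2)] at hmid
  rw [e2, heq] at hpar
  have hpos : 0 < ‖proj K u - y‖ := norm_pos_iff.mpr (sub_ne_zero.mpr hne)
  nlinarith [norm_nonneg (y - u)]

/-- A weak Pareto point of `min (f₁, …, fₘ)`: no `y` is strictly better in every objective. -/
def IsWeakPareto {n m : ℕ} (f : Fin m → EuclideanSpace ℝ (Fin n) → ℝ)
    (x : EuclideanSpace ℝ (Fin n)) : Prop :=
  ¬ ∃ y, ∀ i, f i y < f i x

/-- `C(x) = conv {∇ f₁ x, …, ∇ fₘ x}`. -/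
noncomputable def gradHull {n m : ℕ} (f : Fin m → EuclideanSpace ℝ (Fin n) → ℝ)
    (x : EuclideanSpace ℝ (Fin n)) : Set (EuclideanSpace ℝ (Fin n)) :=
  convexHull ℝ (range fun i => gradient (f i) x)

/-- The normalized gradient term
`r(t, x, v) = (α - β) / t ^ p * (‖v‖ / ‖proj_{C(x)} 0‖) • proj_{C(x)} 0`,
read as `0` at the points where `proj_{C(x)} 0 = 0`. -/
noncomputable def normGradTerm {n m : ℕ} (f : Fin m → EuclideanSpace ℝ (Fin n) → ℝ)
    (α β p t : ℝ) (x v : EuclideanSpace ℝ (Fin n)) : EuclideanSpace ℝ (Fin n) :=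
  ((α - β) / t ^ p * (‖v‖ / ‖proj (gradHull f x) 0‖)) • proj (gradHull f x) 0

/-- `x` is a (Carathéodory) solution on `[t₀, ∞)` of the Cauchy problem
`(α / t) x' + proj_{C(x) + r(t, x, x') + x''} 0 = 0`, `x(t₀) = x₀`, `x'(t₀) = v₀`:
`x` is `C¹` with velocity `v = x'` absolutely continuous on every compact interval, `a = x''` is the
almost everywhere derivative of `v`, and the equation holds for almost every `t ≥ t₀`. -/
def IsSolution {n m : ℕ} (f : Fin m → EuclideanSpace ℝ (Fin n) → ℝ) (α β p t₀ : ℝ)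
    (x₀ v₀ : EuclideanSpace ℝ (Fin n)) (x : ℝ → EuclideanSpace ℝ (Fin n)) : Prop :=
  ∃ v a : ℝ → EuclideanSpace ℝ (Fin n),
    (∀ t, t₀ ≤ t → HasDerivWithinAt x (v t) (Ici t₀) t) ∧
    (∀ T, t₀ ≤ T → AbsolutelyContinuousOnInterval v t₀ T) ∧
    (∀ᵐ t ∂volume, t₀ ≤ t → HasDerivAt v (a t) t) ∧
    (∀ᵐ t ∂volume, t₀ ≤ t →
      (α / t) • v t +
        proj ((fun g => g + normGradTerm f α β p t (x t) (v t) + a t) '' gradHull f (x t)) 0 = 0) ∧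
    x t₀ = x₀ ∧ v t₀ = v₀

end MultiobjFlow

/-! The projection equation says that the acceleration is `-(α / t) v - g - r`, where `g` in the
hull of the gradients maximizes the pairing with `v`. Of `r` only the bound `‖r‖ ≤ (α - β) t ^ (-p)
‖v‖` matters: for `t ≥ 1` it costs at most `(α - β) / t` of the damping `α / t`, leaving an
effective `β / t` with `β > 3`, and its pairing with the bounded `x - z` is absorbed by Young's
inequality, with an error of order `t ^ (1 - 2 p)`, integrable since `p > 1`.

For every reference point `z` this makes the Lyapunov function `energy` nonincreasing
(`antitoneOn_energy`). Taking `z = x(t)` gives `‖v(t)‖ = O(1 / t)`. If `x` tends to `y` and some `z`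
were strictly better than `y` in all objectives, the term `t ^ 2 * minGap f z (x t)` would tend to
infinity, which the energy forbids; so a limit is weakly Pareto.

Convergence is an argument of Opial type. Each `f i (x t) + ‖v t‖ ^ 2 / 2` decreases, so `f i (x t)`
has a limit `l i`, and a cluster point `z` of the bounded trajectory has `f i z = l i` for all `i`.
For such `z` the energy bounds the integral of `t ‖v‖ ^ 2`. With `h = ‖x - z‖ ^ 2`, the function `t
h' + (α - 1) h` then converges (`antitoneOn_anchor`), hence so does `h`; its limit is `0` along a
subsequence, so `x` tends to `z`. -/

namespace AbsolutelyContinuousOnInterval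

/-! ### Closure properties of absolute continuity -/

variable {F : Type*} {a b : ℝ}

theorem norm [NormedAddCommGroup F] {u : ℝ → F} (hu : AbsolutelyContinuousOnInterval u a b) :
    AbsolutelyContinuousOnInterval (fun t => ‖u t‖) a b := by
  refine squeeze_zero (fun E => ?_) (fun E => ?_) hu
  · exact Finset.sum_nonneg fun i _ => dist_nonneg
  · exact Finset.sum_le_sum fun i _ => (dist_norm_norm_le _ _).trans_eq (dist_eq_norm _ _).symm

theorem norm_sq [NormedAddCommGroup F] {u : ℝ → F} (hu : AbsolutelyContinuousOnInterval u a b) :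
    AbsolutelyContinuousOnInterval (fun t => ‖u t‖ ^ 2) a b := by
  simpa only [sq] using hu.norm.fun_mul hu.norm

theorem inner [NormedAddCommGroup F] [InnerProductSpace ℝ F] {u w : ℝ → F}
    (hu : AbsolutelyContinuousOnInterval u a b) (hw : AbsolutelyContinuousOnInterval w a b) :
    AbsolutelyContinuousOnInterval (fun t => inner ℝ (u t) (w t)) a b := by
  -- Polarization.
  have h := ((hu.fun_add hw).norm_sq.fun_sub (hu.fun_sub hw).norm_sq).const_mul (1 / 4)
  convert h using 2 with t
  rw [norm_add_sq_real, norm_sub_sq_real]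
  ring

theorem inf {u w : ℝ → ℝ} (hu : AbsolutelyContinuousOnInterval u a b)
    (hw : AbsolutelyContinuousOnInterval w a b) :
    AbsolutelyContinuousOnInterval (fun t => u t ⊓ w t) a b := by
  have h := ((hu.fun_add hw).fun_sub (hu.fun_sub hw).norm).const_mul (1 / 2)
  convert h using 2 with t
  rcases le_total (u t) (w t) with h | h
  · rw [inf_eq_left.2 h, Real.norm_eq_abs, abs_of_nonpos (sub_nonpos.2 h)]
    ring
  · rw [inf_eq_right.2 h, Real.norm_eq_abs, abs_of_nonneg (sub_nonneg.2 h)]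
    ring

theorem finset_inf' {ι : Type*} {s : Finset ι} (hs : s.Nonempty) {u : ι → ℝ → ℝ}
    (hu : ∀ i ∈ s, AbsolutelyContinuousOnInterval (u i) a b) :
    AbsolutelyContinuousOnInterval (fun t => s.inf' hs fun i => u i t) a b := by
  have h := Finset.inf'_induction hs u
    (p := fun w : ℝ → ℝ => AbsolutelyContinuousOnInterval w a b)
    (fun w₁ h₁ w₂ h₂ => h₁.inf h₂) hu
  convert h using 1
  ext t
  rw [Finset.inf'_apply]

theorem of_hasDerivWithinAt [NormedAddCommGroup F] [NormedSpace ℝ F] {u u' : ℝ → F} (hab : a ≤ b)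
    (hu : ∀ t ∈ Icc a b, HasDerivWithinAt u (u' t) (Icc a b) t) (hc : ContinuousOn u' (Icc a b)) :
    AbsolutelyContinuousOnInterval u a b := by
  obtain ⟨C, hC⟩ := isCompact_Icc.exists_bound_of_continuousOn hc
  refine LipschitzOnWith.absolutelyContinuousOnInterval (K := C.toNNReal) ?_
  rw [uIcc_of_le hab]
  refine (convex_Icc a b).lipschitzOnWith_of_nnnorm_hasDerivWithin_le hu fun t ht => ?_
  rw [← NNReal.coe_le_coe, coe_nnnorm]
  exact (hC t ht).trans (Real.le_coe_toNNReal C)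

end AbsolutelyContinuousOnInterval

namespace MultiobjFlow

/-! ### Monotonicity and limits on a half-line -/

theorem antitoneOn_of_ae_hasDerivAt_nonpos {φ : ℝ → ℝ} {t₀ : ℝ}
    (hac : ∀ T, t₀ ≤ T → AbsolutelyContinuousOnInterval φ t₀ T)
    (hd : ∀ᵐ t ∂volume, t₀ < t → ∃ d ≤ 0, HasDerivAt φ d t) : AntitoneOn φ (Ici t₀) := by
  intro s hs t ht hst
  have hst' : AbsolutelyContinuousOnInterval φ s t := by
    refine (hac t ht).mono ?_
    rw [uIcc_of_le hst, uIcc_of_le ht]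
    exact Icc_subset_Icc_left hs
  have h := hst'.integral_deriv_eq_sub
  have h2 : ∫ r in s..t, deriv φ r ≤ 0 := by
    have h3 := intervalIntegral.integral_mono_ae_restrict hst hst'.intervalIntegrable_deriv
      (intervalIntegrable_const (c := (0 : ℝ))) ?_
    · simpa using h3
    · rw [Filter.EventuallyLE, ae_restrict_iff' measurableSet_Icc]
      have hne : ∀ᵐ r ∂(volume : Measure ℝ), r ≠ s := by simp [ae_iff, measure_singleton]
      filter_upwards [hd, hne] with r hr hrs hmem
      obtain ⟨d, hd0, hdd⟩ := hr (lt_of_le_of_lt hs (lt_of_le_of_ne hmem.1 hrs.symm))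
      rw [hdd.deriv]
      exact hd0
  linarith

theorem exists_tendsto_of_antitoneOn {φ : ℝ → ℝ} {t₀ C : ℝ} (hφ : AntitoneOn φ (Ici t₀))
    (hC : ∀ t, t₀ ≤ t → C ≤ φ t) :
    ∃ l, Tendsto φ atTop (𝓝 l) ∧ ∀ t, t₀ ≤ t → l ≤ φ t := by
  have hanti : Antitone fun t => φ (max t₀ t) := fun s t hst =>
    hφ (mem_Ici.2 (le_max_left _ _)) (mem_Ici.2 (le_max_left _ _)) (max_le_max_left _ hst)
  have hb : BddBelow (range fun t => φ (max t₀ t)) := by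
    refine ⟨C, ?_⟩
    rintro _ ⟨t, rfl⟩
    exact hC _ (le_max_left _ _)
  refine ⟨_, (tendsto_atTop_ciInf hanti hb).congr' ?_, fun t ht => ?_⟩
  · filter_upwards [eventually_ge_atTop t₀] with t ht
    rw [max_eq_right ht]
  · simpa [max_eq_right ht] using ciInf_le hb t

/-- With the integrating factor `t ^ κ`, the derivative of `t ^ κ (y - ε)` is `t ^ (κ - 1) (t y' + κ
y - κ ε)`, which is eventually nonpositive; so `y - ε` is at most a multiple of `t ^ (-κ)`. -/
theorem eventually_le_of_tendsto_mul_deriv_add {y y' : ℝ → ℝ} {t₀ κ ε : ℝ} (hκ : 0 < κ)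
    (hε : 0 < ε) (hy : ∀ t, t₀ < t → HasDerivAt y (y' t) t)
    (hlim : Tendsto (fun t => t * y' t + κ * y t) atTop (𝓝 0)) : ∀ᶠ t in atTop, y t ≤ 2 * ε := by
  have h1 : ∀ᶠ t in atTop, t * y' t + κ * y t < κ * ε :=
    hlim.eventually_lt_const (by positivity)
  obtain ⟨T, hT⟩ := eventually_atTop.1
    (h1.and ((eventually_gt_atTop t₀).and (eventually_gt_atTop (0 : ℝ))))
  have hder : ∀ t, T ≤ t → HasDerivAt (fun t => t ^ κ * (y t - ε))
      (κ * t ^ (κ - 1) * (y t - ε) + t ^ κ * y' t) t := fun t ht =>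
    (Real.hasDerivAt_rpow_const (Or.inl (hT t ht).2.2.ne')).mul ((hy t (hT t ht).2.1).sub_const ε)
  have hanti : AntitoneOn (fun t => t ^ κ * (y t - ε)) (Ici T) := by
    refine antitoneOn_of_hasDerivWithinAt_nonpos (convex_Ici T)
      (fun t ht => (hder t ht).continuousAt.continuousWithinAt)
      (fun t ht => (hder t (interior_subset ht)).hasDerivWithinAt) fun t ht => ?_
    obtain ⟨ha, -, hb⟩ := hT t (interior_subset ht)
    have hpow : t ^ κ = t ^ (κ - 1) * t := by rw [Real.rpow_sub_one hb.ne', div_mul_cancel₀ _ hb.ne']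
    rw [hpow]
    have := Real.rpow_pos_of_pos hb (κ - 1)
    nlinarith
  have hlim2 : Tendsto (fun t : ℝ => T ^ κ * (y T - ε) / t ^ κ) atTop (𝓝 0) :=
    (tendsto_rpow_atTop hκ).const_div_atTop _
  filter_upwards [hlim2.eventually_lt_const hε, eventually_ge_atTop T] with t ht htT
  have hb := Real.rpow_pos_of_pos (hT t htT).2.2 κ
  have h := hanti (mem_Ici.2 le_rfl) (mem_Ici.2 htT) htT
  rw [div_lt_iff₀ hb] at ht
  have h2 : t ^ κ * (y t - ε) ≤ T ^ κ * (y T - ε) := h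
  by_contra! hcon
  nlinarith

theorem tendsto_of_tendsto_mul_deriv_add {y y' : ℝ → ℝ} {t₀ κ l : ℝ} (hκ : 0 < κ)
    (hy : ∀ t, t₀ < t → HasDerivAt y (y' t) t)
    (hlim : Tendsto (fun t => t * y' t + κ * y t) atTop (𝓝 l)) :
    Tendsto y atTop (𝓝 (l / κ)) := by
  have e : Tendsto (fun t => t * y' t + κ * (y t - l / κ)) atTop (𝓝 0) := by
    have := hlim.sub_const l
    rw [sub_self] at this
    refine this.congr fun t => ?_
    field_simp
    ring
  have e' : Tendsto (fun t => t * (-y' t) + κ * (-(y t - l / κ))) atTop (𝓝 0) := by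
    have := e.neg
    rw [neg_zero] at this
    exact this.congr fun t => by ring
  rw [Metric.tendsto_nhds]
  intro ε hε
  filter_upwards [eventually_le_of_tendsto_mul_deriv_add hκ (by positivity : 0 < ε / 4)
      (fun t ht => (hy t ht).sub_const (l / κ)) e,
    eventually_le_of_tendsto_mul_deriv_add hκ (by positivity : 0 < ε / 4)
      (fun t ht => ((hy t ht).sub_const (l / κ)).neg) e'] with t h1 h2
  simp only [Pi.neg_apply] at h2
  rw [Real.dist_eq, abs_lt]
  constructor <;> linarith

/-! ### Convexity and the variational inequality of the projection -/

theorem inner_gradient_le_sub {F : Type*} [NormedAddCommGroup F] [InnerProductSpace ℝ F]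
    [CompleteSpace F] {f : F → ℝ} (hf : ConvexOn ℝ univ f) {x : F} (hd : DifferentiableAt ℝ f x)
    (z : F) : f x - f z ≤ inner ℝ (x - z) (gradient f x) := by
  have hline : HasDerivAt (fun s : ℝ => f (x + s • (z - x))) (inner ℝ (gradient f x) (z - x)) 0 := by
    have h1 : HasDerivAt (fun s : ℝ => x + s • (z - x)) (z - x) 0 := by
      simpa using ((hasDerivAt_id (0 : ℝ)).smul_const (z - x)).const_add x
    have h2 : HasFDerivAt f (InnerProductSpace.toDual ℝ F (gradient f x)) (x + (0 : ℝ) • (z - x)) := by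
      simpa using hd.hasGradientAt.hasFDerivAt
    exact h2.comp_hasDerivAt (0 : ℝ) h1
  have hslope := hline.tendsto_slope_zero_right
  have hle : inner ℝ (gradient f x) (z - x) ≤ f z - f x := by
    refine le_of_tendsto hslope ?_
    filter_upwards [Ioo_mem_nhdsGT (zero_lt_one' ℝ)] with s hs
    have hc := hf.2 (mem_univ x) (mem_univ z) (sub_nonneg.2 hs.2.le) hs.1.le (by ring)
    have e : (1 - s) • x + s • z = x + s • (z - x) := by module
    rw [e] at hc
    simp only [zero_add, zero_smul, add_zero, smul_eq_mul] at hc ⊢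
    rw [inv_mul_le_iff₀ hs.1]
    linarith
  rw [← neg_sub z x, inner_neg_left, real_inner_comm]
  linarith

theorem inner_proj_zero_le {n : ℕ} {K : Set (EuclideanSpace ℝ (Fin n))} (hne : K.Nonempty)
    (hcl : IsClosed K) (hK : Convex ℝ K) {z : EuclideanSpace ℝ (Fin n)} (hz : z ∈ K) :
    inner ℝ (proj K 0) (proj K 0) ≤ inner ℝ (proj K 0) z := by
  obtain ⟨h1, h2⟩ := proj_spec hne hcl 0
  have : Nonempty K := hne.to_subtype
  have h3 : ‖0 - proj K 0‖ = ⨅ w : K, ‖0 - (w : EuclideanSpace ℝ (Fin n))‖ := by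
    refine le_antisymm (le_ciInf fun w => ?_) (ciInf_le ⟨0, ?_⟩ (⟨proj K 0, h1⟩ : K))
    · simpa using h2 w w.2
    · rintro _ ⟨w, rfl⟩
      exact norm_nonneg _
  have h4 := (norm_eq_iInf_iff_real_inner_le_zero hK h1).1 h3 z hz
  rw [zero_sub, inner_neg_left, inner_sub_right] at h4
  linarith

/-! ### The differential equation in resolved form -/

variable {n m : ℕ} {f : Fin m → EuclideanSpace ℝ (Fin n) → ℝ} {α β p t₀ : ℝ}
  {x v : ℝ → EuclideanSpace ℝ (Fin n)}

/-- The differential equation in resolved form: the acceleration is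
`-(α / t) v - g - r` with `g ∈ C(x)` maximizing `⟪·, v⟫` over the gradients. -/
structure IsTrajectory (f : Fin m → EuclideanSpace ℝ (Fin n) → ℝ) (α β p t₀ : ℝ)
    (x v : ℝ → EuclideanSpace ℝ (Fin n)) : Prop where
  hasDerivWithinAt : ∀ t, t₀ ≤ t → HasDerivWithinAt x (v t) (Ici t₀) t
  absolutelyContinuous : ∀ T, t₀ ≤ T → AbsolutelyContinuousOnInterval v t₀ T
  ae_eq : ∀ᵐ t ∂volume, t₀ < t → ∃ a g r : EuclideanSpace ℝ (Fin n), HasDerivAt v a t ∧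
    g ∈ gradHull f (x t) ∧ a = -(α / t) • v t - g - r ∧
    (∀ i, inner ℝ (gradient (f i) (x t)) (v t) ≤ inner ℝ g (v t)) ∧
    ‖r‖ ≤ (α - β) * t ^ (-p) * ‖v t‖

theorem norm_normGradTerm_le (hαβ : β ≤ α) {t : ℝ} (ht : 0 ≤ t)
    (y w : EuclideanSpace ℝ (Fin n)) :
    ‖normGradTerm f α β p t y w‖ ≤ (α - β) * t ^ (-p) * ‖w‖ := by
  have h0 : 0 ≤ (α - β) / t ^ p := div_nonneg (sub_nonneg.2 hαβ) (Real.rpow_nonneg ht p)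
  rw [normGradTerm, norm_smul, Real.norm_of_nonneg (by positivity), mul_assoc, Real.rpow_neg ht,
    ← div_eq_mul_inv]
  refine mul_le_mul_of_nonneg_left ?_ h0
  -- If the projection vanishes, division by zero returns `0`, in agreement with the convention `r =
  -- 0`.
  rcases eq_or_ne ‖proj (gradHull f y) 0‖ 0 with h | h
  · simp [h]
  · rw [div_mul_cancel₀ _ h]

theorem isCompact_gradHull (y : EuclideanSpace ℝ (Fin n)) : IsCompact (gradHull f y) :=
  (finite_range _).isCompact_convexHull ℝ

theorem gradient_mem_gradHull (i : Fin m) (y : EuclideanSpace ℝ (Fin n)) :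
    gradient (f i) y ∈ gradHull f y :=
  subset_convexHull ℝ _ (mem_range_self i)

/-- The projection equals `-(α / t) w` and lies in the translated hull, which yields `g`. In the
variational inequality of the projection the translation `r + a` cancels, and the negative factor
`-(α / t)` turns minimality into maximality of the pairing of `g` with `w`. -/
theorem exists_mem_gradHull_of_proj_eq [Nonempty (Fin m)] {t : ℝ} (ht : 0 < t) (hα : 0 < α)
    {y w a r : EuclideanSpace ℝ (Fin n)}
    (h : (α / t) • w + proj ((fun g => g + r + a) '' gradHull f y) 0 = 0) :
    ∃ g ∈ gradHull f y, a = -(α / t) • w - g - r ∧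
      ∀ i, inner ℝ (gradient (f i) y) w ≤ inner ℝ g w := by
  set K := (fun g => g + r + a) '' gradHull f y with hK
  have hcomp : IsCompact K := (isCompact_gradHull y).image (by fun_prop)
  have hne : K.Nonempty :=
    ⟨_, mem_image_of_mem _ (gradient_mem_gradHull (Classical.arbitrary (Fin m)) y)⟩
  have hconv : Convex ℝ K := by
    have e : K = (fun g => g + (r + a)) '' gradHull f y := by simp only [hK, add_assoc]
    rw [e]
    have h2 := (convex_convexHull ℝ (range fun i => gradient (f i) y)).translate (r + a)
    simp only [add_comm (r + a)] at h2
    exact h2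
  obtain ⟨g, hg, hgp⟩ := (proj_spec hne hcomp.isClosed 0).1
  have hp : proj K 0 = -(α / t) • w := by
    rw [neg_smul]
    exact eq_neg_of_add_eq_zero_right h
  simp only [hp] at hgp
  refine ⟨g, hg, by rw [← hgp]; abel, fun i => ?_⟩
  have h2 := inner_proj_zero_le hne hcomp.isClosed hconv
    (mem_image_of_mem _ (gradient_mem_gradHull i y))
  have hpos : 0 < α / t := div_pos hα ht
  rw [hp] at h2
  nth_rewrite 2 [← hgp] at h2
  simp only [inner_smul_left, inner_add_right, conj_trivial, neg_mul] at h2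
  rw [real_inner_comm w, real_inner_comm w]
  nlinarith

theorem IsSolution.exists_isTrajectory [Nonempty (Fin m)] (hα : 0 < α) (hαβ : β ≤ α) (ht₀ : 0 < t₀)
    {x₀ v₀ : EuclideanSpace ℝ (Fin n)} (hx : IsSolution f α β p t₀ x₀ v₀ x) :
    ∃ v, IsTrajectory f α β p t₀ x v := by
  obtain ⟨v, a, h1, h2, h3, h4, -, -⟩ := hx
  refine ⟨v, h1, h2, ?_⟩
  filter_upwards [h3, h4] with t h3 h4 ht
  have ht0 := ht₀.trans ht
  obtain ⟨g, hg, he, hi⟩ := exists_mem_gradHull_of_proj_eq ht0 hα (h4 ht.le)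
  exact ⟨a t, g, _, h3 ht.le, hg, he, hi, norm_normGradTerm_le hαβ ht0.le _ _⟩

theorem le_inner_of_mem_gradHull {y u g : EuclideanSpace ℝ (Fin n)} {c : ℝ}
    (hg : g ∈ gradHull f y) (h : ∀ i, c ≤ inner ℝ u (gradient (f i) y)) : c ≤ inner ℝ u g := by
  have hsub : gradHull f y ⊆ {w | c ≤ inner ℝ u w} := by
    refine convexHull_min ?_ (convex_halfSpace_ge (innerₗ _ u).isLinear c)
    rintro _ ⟨i, rfl⟩
    exact h i
  exact hsub hg

/-- `minᵢ (fᵢ(y) - fᵢ(z))`. -/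
noncomputable def minGap [Nonempty (Fin m)] (f : Fin m → EuclideanSpace ℝ (Fin n) → ℝ)
    (z y : EuclideanSpace ℝ (Fin n)) : ℝ :=
  Finset.univ.inf' Finset.univ_nonempty fun i => f i y - f i z

theorem minGap_le [Nonempty (Fin m)] (z y : EuclideanSpace ℝ (Fin n)) (i : Fin m) :
    minGap f z y ≤ f i y - f i z :=
  Finset.inf'_le _ (Finset.mem_univ i)

/-- The primitive of `t ‖v(t)‖²` vanishing at `t₀`. -/
noncomputable def kineticIntegral (t₀ : ℝ) (v : ℝ → EuclideanSpace ℝ (Fin n)) (t : ℝ) : ℝ :=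
  ∫ s in t₀..t, s * ‖v (max t₀ s)‖ ^ 2

/-! ### Regularity along a trajectory -/

namespace IsTrajectory

theorem hasDerivAt (hx : IsTrajectory f α β p t₀ x v) {t : ℝ} (ht : t₀ < t) :
    HasDerivAt x (v t) t :=
  (hx.hasDerivWithinAt t ht.le).hasDerivAt (Ici_mem_nhds ht)

theorem continuousOn_velocity (hx : IsTrajectory f α β p t₀ x v) : ContinuousOn v (Ici t₀) := by
  intro t ht
  have h := (hx.absolutelyContinuous (t + 1) (by linarith [mem_Ici.1 ht])).continuousOn
  rw [uIcc_of_le (by linarith [mem_Ici.1 ht])] at h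
  refine (h t ⟨ht, by linarith⟩).mono_of_mem_nhdsWithin ?_
  rw [← Ici_inter_Iic]
  exact inter_mem_nhdsWithin _ (Iic_mem_nhds (by linarith))

theorem continuousOn (hx : IsTrajectory f α β p t₀ x v) : ContinuousOn x (Ici t₀) := fun t ht =>
  (hx.hasDerivWithinAt t ht).continuousWithinAt

theorem ac_position (hx : IsTrajectory f α β p t₀ x v) {T : ℝ} (hT : t₀ ≤ T) :
    AbsolutelyContinuousOnInterval x t₀ T :=
  .of_hasDerivWithinAt hT
    (fun t ht => (hx.hasDerivWithinAt t ht.1).mono Icc_subset_Ici_self)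
    (hx.continuousOn_velocity.mono Icc_subset_Ici_self)

theorem hasDerivWithinAt_comp (hx : IsTrajectory f α β p t₀ x v) (hC1 : ∀ i, ContDiff ℝ 1 (f i))
    (i : Fin m) {t : ℝ} (ht : t₀ ≤ t) :
    HasDerivWithinAt (fun t => f i (x t)) (inner ℝ (gradient (f i) (x t)) (v t)) (Ici t₀) t := by
  have h := ((hC1 i).differentiable one_ne_zero (x t)).hasGradientAt.hasFDerivAt
  exact h.comp_hasDerivWithinAt t (hx.hasDerivWithinAt t ht)

theorem hasDerivAt_comp (hx : IsTrajectory f α β p t₀ x v) (hC1 : ∀ i, ContDiff ℝ 1 (f i))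
    (i : Fin m) {t : ℝ} (ht : t₀ < t) :
    HasDerivAt (fun t => f i (x t)) (inner ℝ (gradient (f i) (x t)) (v t)) t :=
  (hx.hasDerivWithinAt_comp hC1 i ht.le).hasDerivAt (Ici_mem_nhds ht)

theorem ac_comp (hx : IsTrajectory f α β p t₀ x v) (hC1 : ∀ i, ContDiff ℝ 1 (f i))
    (i : Fin m) {T : ℝ} (hT : t₀ ≤ T) :
    AbsolutelyContinuousOnInterval (fun t => f i (x t)) t₀ T := by
  refine .of_hasDerivWithinAt hT
    (fun t ht => (hx.hasDerivWithinAt_comp hC1 i ht.1).mono Icc_subset_Ici_self) ?_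
  have hg : Continuous (gradient (f i)) :=
    (InnerProductSpace.toDual ℝ _).symm.continuous.comp ((hC1 i).continuous_fderiv one_ne_zero)
  exact ((hg.comp_continuousOn hx.continuousOn).inner hx.continuousOn_velocity).mono
    Icc_subset_Ici_self

theorem ac_minGap [Nonempty (Fin m)] (hx : IsTrajectory f α β p t₀ x v)
    (hC1 : ∀ i, ContDiff ℝ 1 (f i)) (z : EuclideanSpace ℝ (Fin n)) {T : ℝ} (hT : t₀ ≤ T) :
    AbsolutelyContinuousOnInterval (fun t => minGap f z (x t)) t₀ T := by
  refine .finset_inf' _ fun i _ => (hx.ac_comp hC1 i hT).fun_sub ?_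
  exact (LipschitzWith.const (f i z)).lipschitzOnWith.absolutelyContinuousOnInterval

/-- Almost everywhere the derivative of `minᵢ fᵢ(x) - fᵢ(z)` is that of an active index. -/
theorem ae_hasDerivAt_minGap [Nonempty (Fin m)] (hx : IsTrajectory f α β p t₀ x v)
    (hC1 : ∀ i, ContDiff ℝ 1 (f i)) (z : EuclideanSpace ℝ (Fin n)) :
    ∀ᵐ t ∂volume, t₀ < t → ∃ i, HasDerivAt (fun t => minGap f z (x t))
      (inner ℝ (gradient (f i) (x t)) (v t)) t := by
  -- Countably many compact intervals exhaust the half-line, so their null sets can be united.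
  have hae : ∀ k : ℕ, ∀ᵐ t ∂volume, t ∈ uIcc t₀ (t₀ + k) →
      DifferentiableAt ℝ (fun t => minGap f z (x t)) t := fun k =>
    (hx.ac_minGap hC1 z (by simp)).ae_differentiableAt
  filter_upwards [ae_all_iff.2 hae] with t ht htt
  obtain ⟨k, hk⟩ := exists_nat_ge (t - t₀)
  have hd := ht k (by rw [uIcc_of_le (by simp)]; exact ⟨htt.le, by linarith⟩)
  obtain ⟨i, -, hi⟩ := Finset.exists_mem_eq_inf' Finset.univ_nonempty fun i => f i (x t) - f i z
  refine ⟨i, ?_⟩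
  have hi' := (hx.hasDerivAt_comp hC1 i htt).sub_const (f i z)
  -- An active index `i` touches the minimum from above at `t`, so the two derivatives agree
  -- wherever both exist.
  have hmin : IsLocalMin (fun s => (f i (x s) - f i z) - minGap f z (x s)) t := by
    refine Eventually.of_forall fun s => ?_
    have h1 : minGap f z (x t) = f i (x t) - f i z := hi
    have h2 := minGap_le (f := f) z (x s) i
    simp only [h1, sub_self]
    linarith
  have h0 := hmin.hasDerivAt_eq_zero (hi'.sub hd.hasDerivAt)
  rw [sub_eq_zero.1 h0]
  exact hd.hasDerivAt

/-- The truncation `max t₀ s` makes the integrand of `kineticIntegral` continuous on the whole line,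
so that its primitive is differentiable from both sides at `t₀` too. -/
theorem continuous_velocity_max (hx : IsTrajectory f α β p t₀ x v) :
    Continuous fun s => v (max t₀ s) :=
  hx.continuousOn_velocity.comp_continuous (by fun_prop) fun s => mem_Ici.2 (le_max_left _ _)

theorem hasDerivAt_kineticIntegral (hx : IsTrajectory f α β p t₀ x v) {t : ℝ} (ht : t₀ ≤ t) :
    HasDerivAt (kineticIntegral t₀ v) (t * ‖v t‖ ^ 2) t := by
  have hc : Continuous fun s => s * ‖v (max t₀ s)‖ ^ 2 :=
    continuous_id.mul (hx.continuous_velocity_max.norm.pow 2)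
  have h := (hc.integral_hasStrictDerivAt t₀ t).hasDerivAt
  rw [max_eq_right ht] at h
  exact h

theorem ac_kineticIntegral (hx : IsTrajectory f α β p t₀ x v) {T : ℝ} (hT : t₀ ≤ T) :
    AbsolutelyContinuousOnInterval (kineticIntegral t₀ v) t₀ T := by
  refine .of_hasDerivWithinAt hT
    (fun t ht => (hx.hasDerivAt_kineticIntegral ht.1).hasDerivWithinAt) ?_
  exact continuousOn_id.mul
    ((hx.continuousOn_velocity.mono Icc_subset_Ici_self).norm.pow 2)

theorem monotoneOn_kineticIntegral (hx : IsTrajectory f α β p t₀ x v) (ht₀ : 0 ≤ t₀) :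
    MonotoneOn (kineticIntegral t₀ v) (Ici t₀) := by
  refine monotoneOn_of_hasDerivWithinAt_nonneg (convex_Ici t₀)
    (fun t ht => (hx.hasDerivAt_kineticIntegral ht).continuousAt.continuousWithinAt)
    (fun t ht => (hx.hasDerivAt_kineticIntegral (interior_subset ht)).hasDerivWithinAt) fun t ht => ?_
  have : 0 ≤ t := ht₀.trans (interior_subset ht)
  positivity

theorem kineticIntegral_nonneg (hx : IsTrajectory f α β p t₀ x v) (ht₀ : 0 ≤ t₀) {t : ℝ}
    (ht : t₀ ≤ t) : 0 ≤ kineticIntegral t₀ v t := by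
  have h := hx.monotoneOn_kineticIntegral ht₀ (mem_Ici.2 le_rfl) ht ht
  simpa [kineticIntegral] using h

end IsTrajectory

/-! ### Lyapunov functions -/

theorem rpow_neg_mul_le {p t : ℝ} (hp : 1 ≤ p) (ht : 1 ≤ t) : t * t ^ (-p) ≤ 1 := by
  have ht0 : 0 < t := by linarith
  have h : t ^ (1 + -p) ≤ 1 := Real.rpow_le_one_of_one_le_of_nonpos ht (by linarith)
  rwa [Real.rpow_add ht0, Real.rpow_one] at h

/-- The tail `t ^ (2 - 2 * p)` compensates the Young error `K t τ ^ 2` with `τ = t ^ (-p)`; the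
derivative is written in that shape. -/
theorem hasDerivAt_rpow_tail (p : ℝ) {t : ℝ} (ht : 0 < t) :
    HasDerivAt (fun t : ℝ => t ^ (2 - 2 * p)) (-(2 * p - 2) * (t * (t ^ (-p)) ^ 2)) t := by
  convert Real.hasDerivAt_rpow_const (Or.inl ht.ne') using 1
  have e : (2 - 2 * p - 1) = 1 + ((-p) + (-p)) := by ring
  rw [e, Real.rpow_add ht, Real.rpow_add ht, Real.rpow_one]
  ring

theorem ac_rpow_tail (p : ℝ) {t₀ T : ℝ} (ht₀ : 0 < t₀) (hT : t₀ ≤ T) :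
    AbsolutelyContinuousOnInterval (fun t : ℝ => t ^ (2 - 2 * p)) t₀ T := by
  refine .of_hasDerivWithinAt hT
    (fun t ht => (hasDerivAt_rpow_tail p (ht₀.trans_le ht.1)).hasDerivWithinAt) ?_
  refine continuousOn_const.mul (continuousOn_id.mul (ContinuousOn.pow ?_ 2))
  exact continuousOn_id.rpow_const fun t ht => Or.inl (ht₀.trans_le ht.1).ne'

theorem ac_id (a b : ℝ) : AbsolutelyContinuousOnInterval (fun t : ℝ => t) a b :=
  LipschitzWith.id.lipschitzOnWith.absolutelyContinuousOnInterval

theorem ac_const {F : Type*} [NormedAddCommGroup F] (c : F) (a b : ℝ) :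
    AbsolutelyContinuousOnInterval (fun _ : ℝ => c) a b :=
  (LipschitzWith.const c).lipschitzOnWith.absolutelyContinuousOnInterval

/-- The Lyapunov function attached to a reference point `z`. -/
noncomputable def energy [Nonempty (Fin m)] (f : Fin m → EuclideanSpace ℝ (Fin n) → ℝ)
    (α β p t₀ K : ℝ) (x v : ℝ → EuclideanSpace ℝ (Fin n)) (z : EuclideanSpace ℝ (Fin n))
    (t : ℝ) : ℝ :=
  t ^ 2 * minGap f z (x t) + 1 / 2 * ‖(2 : ℝ) • (x t - z) + t • v t‖ ^ 2 + (α - 3) * ‖x t - z‖ ^ 2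
    + (β - 3) / 2 * kineticIntegral t₀ v t + K / (2 * p - 2) * t ^ (2 - 2 * p)

namespace IsTrajectory

/-- The factor `2` in `2 (x - z) + t v` and the weight `α - 3` cancel all multiples of `⟪x - z, v⟫`.
Convexity gives `minGap ≤ ⟪x - z, g⟫`, and the maximality of `g` controls the derivative of
`minGap`. The coefficient of `t ‖v‖ ^ 2` is then at most `(3 - α) + (α - β) = -(β - 3)`: one half
pays for Young's inequality `hK`, the other for the kinetic integral in the energy. -/
theorem antitoneOn_energy [Nonempty (Fin m)] (hx : IsTrajectory f α β p t₀ x v)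
    (hconv : ∀ i, ConvexOn ℝ univ (f i)) (hC1 : ∀ i, ContDiff ℝ 1 (f i)) (hαβ : β < α)
    (hp : 1 < p) (ht₀ : 1 ≤ t₀) {R K : ℝ} {z : EuclideanSpace ℝ (Fin n)}
    (hK : ∀ V τ : ℝ, 2 * R * (α - β) * (τ * V) ≤ (β - 3) / 2 * V ^ 2 + K * τ ^ 2)
    (hR : ∀ t, t₀ ≤ t → ‖x t - z‖ ≤ R) :
    AntitoneOn (energy f α β p t₀ K x v z) (Ici t₀) := by
  have ht₀' : 0 < t₀ := by linarith
  refine antitoneOn_of_ae_hasDerivAt_nonpos (fun T hT => ?_) ?_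
  · have hxz := (hx.ac_position hT).fun_sub (ac_const z t₀ T)
    have hid := ac_id t₀ T
    have h1 := ((hid.fun_mul hid).fun_mul (hx.ac_minGap hC1 z hT))
    have h2 := (((hxz.const_smul (2 : ℝ)).fun_add
      (hid.fun_smul (hx.absolutelyContinuous T hT))).norm_sq).const_mul (1 / 2)
    have h3 := hxz.norm_sq.const_mul (α - 3)
    have h4 := (hx.ac_kineticIntegral hT).const_mul ((β - 3) / 2)
    have h5 := (ac_rpow_tail p ht₀' hT).const_mul (K / (2 * p - 2))
    simp only [← sq] at h1
    exact (((h1.fun_add h2).fun_add h3).fun_add h4).fun_add h5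
  · filter_upwards [hx.ae_hasDerivAt_minGap hC1 z, hx.ae_eq] with t hmin heq ht
    obtain ⟨i, hmin⟩ := hmin ht
    obtain ⟨a, g, r, hva, hg, ha, hgi, hr⟩ := heq ht
    have ht0 : 0 < t := ht₀'.trans ht
    have hxz := (hx.hasDerivAt ht).sub_const z
    have hid := hasDerivAt_id' t
    have hd := (((((hid.fun_pow 2).fun_mul hmin).fun_add
      ((((hxz.fun_const_smul (2 : ℝ)).fun_add (hid.fun_smul hva)).norm_sq).const_mul (1 / 2))).fun_add
      (hxz.norm_sq.const_mul (α - 3))).fun_add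
      ((hx.hasDerivAt_kineticIntegral ht.le).const_mul ((β - 3) / 2))).fun_add
      ((hasDerivAt_rpow_tail p ht0).const_mul (K / (2 * p - 2)))
    refine ⟨_, ?_, hd⟩
    set y := x t - z
    set w := v t
    set τ := t ^ (-p)
    have hta : t • a = -α • w - t • g - t • r := by
      rw [ha, smul_sub, smul_sub, smul_smul]
      congr 3
      field_simp
    have hyg : minGap f z (x t) ≤ inner ℝ y g := le_inner_of_mem_gradHull hg fun j =>
      (minGap_le z (x t) j).trans
        (inner_gradient_le_sub (hconv j) ((hC1 j).differentiable one_ne_zero _) z)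
    have hτ : t * τ ≤ 1 := rpow_neg_mul_le hp.le (ht₀.trans ht.le)
    have hyr : -(inner ℝ y r) ≤ R * ((α - β) * τ * ‖w‖) := by
      have h1 := neg_le_of_abs_le (abs_real_inner_le_norm y r)
      have h2 : ‖y‖ * ‖r‖ ≤ R * ((α - β) * τ * ‖w‖) :=
        mul_le_mul (hR t ht.le) hr (norm_nonneg _) ((norm_nonneg _).trans (hR t ht.le))
      linarith
    have hwr : -(inner ℝ w r) ≤ (α - β) * τ * ‖w‖ ^ 2 := by
      have h1 := neg_le_of_abs_le (abs_real_inner_le_norm w r)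
      have h2 := mul_le_mul_of_nonneg_left hr (norm_nonneg w)
      linarith
    have e : inner ℝ ((2 : ℝ) • y + t • w) ((2 : ℝ) • w + (t • a + (1 : ℝ) • w)) =
        2 * (3 - α) * inner ℝ y w - 2 * t * inner ℝ y g - 2 * t * inner ℝ y r
        + t * (3 - α) * ‖w‖ ^ 2 - t ^ 2 * inner ℝ g w - t ^ 2 * inner ℝ w r := by
      rw [hta, real_inner_comm w g]
      simp only [inner_add_left, inner_add_right, inner_sub_right, inner_smul_left,
        inner_smul_right, conj_trivial, real_inner_self_eq_norm_sq]
      ring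
    have hKs : K / (2 * p - 2) * (-(2 * p - 2) * (t * τ ^ 2)) = -(K * (t * τ ^ 2)) := by
      have : 2 * p - 2 ≠ 0 := by linarith
      rw [neg_mul, mul_neg, ← mul_assoc, div_mul_cancel₀ _ this]
    rw [hKs, e]
    have k1 := mul_le_mul_of_nonneg_left hyg (by positivity : 0 ≤ 2 * t)
    have k2 := mul_le_mul_of_nonneg_left (hgi i) (by positivity : 0 ≤ t ^ 2)
    have k3 := mul_le_mul_of_nonneg_left hyr (by positivity : 0 ≤ 2 * t)
    have k4 := mul_le_mul_of_nonneg_left hwr (by positivity : 0 ≤ t ^ 2)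
    have k5 := mul_le_mul_of_nonneg_left (hK ‖w‖ τ) ht0.le
    have k6 := mul_le_mul_of_nonneg_left hτ
      (mul_nonneg (mul_nonneg ht0.le (sub_nonneg.2 hαβ.le)) (sq_nonneg ‖w‖))
    push_cast
    nlinarith

/-- Since `g` maximizes the pairing with `v`, its contribution dominates that of each `∇ fᵢ`,
simultaneously in `i`. The friction `α / t` dominates `r`. -/
theorem antitoneOn_objective (hx : IsTrajectory f α β p t₀ x v)
    (hC1 : ∀ i, ContDiff ℝ 1 (f i)) (hβ : 0 ≤ β) (hαβ : β < α) (hp : 1 < p) (ht₀ : 1 ≤ t₀)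
    (i : Fin m) : AntitoneOn (fun t => f i (x t) + 1 / 2 * ‖v t‖ ^ 2) (Ici t₀) := by
  refine antitoneOn_of_ae_hasDerivAt_nonpos (fun T hT =>
    (hx.ac_comp hC1 i hT).fun_add ((hx.absolutelyContinuous T hT).norm_sq.const_mul _)) ?_
  filter_upwards [hx.ae_eq] with t heq ht
  obtain ⟨a, g, r, hva, -, ha, hgi, hr⟩ := heq ht
  refine ⟨_, ?_, (hx.hasDerivAt_comp hC1 i ht).fun_add (hva.norm_sq.const_mul (1 / 2))⟩
  have ht1 : 1 ≤ t := ht₀.trans ht.le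
  have ht0 : 0 < t := by linarith
  have hwr : -(inner ℝ (v t) r) ≤ (α - β) * t ^ (-p) * ‖v t‖ ^ 2 := by
    have h1 := neg_le_of_abs_le (abs_real_inner_le_norm (v t) r)
    have h2 := mul_le_mul_of_nonneg_left hr (norm_nonneg (v t))
    linarith
  have hτ : t ^ (-p) ≤ 1 / t := by
    rw [le_div_iff₀ ht0, mul_comm]
    exact rpow_neg_mul_le hp.le ht1
  have hc : (α - β) * t ^ (-p) ≤ α / t := by
    calc (α - β) * t ^ (-p) ≤ (α - β) * (1 / t) :=
          mul_le_mul_of_nonneg_left hτ (sub_nonneg.2 hαβ.le)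
      _ ≤ α * (1 / t) := mul_le_mul_of_nonneg_right (by linarith) (by positivity)
      _ = α / t := by ring
  have k := mul_le_mul_of_nonneg_right hc (sq_nonneg ‖v t‖)
  have hi := hgi i
  rw [ha]
  simp only [inner_sub_right, inner_smul_right, real_inner_self_eq_norm_sq]
  rw [real_inner_comm (v t) g] at hi
  linarith

/-- With `h = ‖x - z‖ ^ 2` the first two terms are `t h' + (α - 1) h`, whose derivative is `2 t ‖v‖
^ 2 - 2 t ⟪x - z, g + r⟫`. Hence the weight of the kinetic integral: `2` from the first term, `1`
from `hz` through convexity, and `(β - 3) / 2` from Young's inequality for `r`. -/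
theorem antitoneOn_anchor (hx : IsTrajectory f α β p t₀ x v)
    (hconv : ∀ i, ConvexOn ℝ univ (f i)) (hC1 : ∀ i, ContDiff ℝ 1 (f i))
    (hp : 1 < p) (ht₀ : 1 ≤ t₀) {R K : ℝ} {z : EuclideanSpace ℝ (Fin n)}
    (hK : ∀ V τ : ℝ, 2 * R * (α - β) * (τ * V) ≤ (β - 3) / 2 * V ^ 2 + K * τ ^ 2)
    (hR : ∀ t, t₀ ≤ t → ‖x t - z‖ ≤ R)
    (hz : ∀ i t, t₀ ≤ t → -(1 / 2 * ‖v t‖ ^ 2) ≤ f i (x t) - f i z) :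
    AntitoneOn (fun t => t * (2 * inner ℝ (x t - z) (v t)) + (α - 1) * ‖x t - z‖ ^ 2
      - (3 + (β - 3) / 2) * kineticIntegral t₀ v t + K / (2 * p - 2) * t ^ (2 - 2 * p))
      (Ici t₀) := by
  have ht₀' : 0 < t₀ := by linarith
  refine antitoneOn_of_ae_hasDerivAt_nonpos (fun T hT => ?_) ?_
  · have hxz := (hx.ac_position hT).fun_sub (ac_const z t₀ T)
    exact ((((ac_id t₀ T).fun_mul
      ((hxz.inner (hx.absolutelyContinuous T hT)).const_mul 2)).fun_add
      (hxz.norm_sq.const_mul (α - 1))).fun_sub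
      ((hx.ac_kineticIntegral hT).const_mul _)).fun_add ((ac_rpow_tail p ht₀' hT).const_mul _)
  · filter_upwards [hx.ae_eq] with t heq ht
    obtain ⟨a, g, r, hva, hg, ha, hgi, hr⟩ := heq ht
    have ht0 : 0 < t := ht₀'.trans ht
    have hxz := (hx.hasDerivAt ht).sub_const z
    refine ⟨_, ?_, ((((hasDerivAt_id' t).fun_mul ((hxz.inner ℝ hva).const_mul 2)).fun_add
      (hxz.norm_sq.const_mul (α - 1))).fun_sub
      ((hx.hasDerivAt_kineticIntegral ht.le).const_mul (3 + (β - 3) / 2))).fun_add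
      ((hasDerivAt_rpow_tail p ht0).const_mul (K / (2 * p - 2)))⟩
    set y := x t - z
    set w := v t
    set τ := t ^ (-p)
    have hta : t * inner ℝ y a = -α * inner ℝ y w - t * inner ℝ y g - t * inner ℝ y r := by
      rw [ha]
      simp only [inner_sub_right, inner_smul_right]
      field_simp
    have hyg : -(1 / 2 * ‖w‖ ^ 2) ≤ inner ℝ y g := le_inner_of_mem_gradHull hg fun j =>
      (hz j t ht.le).trans
        (inner_gradient_le_sub (hconv j) ((hC1 j).differentiable one_ne_zero _) z)
    have hyr : -(inner ℝ y r) ≤ R * ((α - β) * τ * ‖w‖) := by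
      have h1 := neg_le_of_abs_le (abs_real_inner_le_norm y r)
      have h2 : ‖y‖ * ‖r‖ ≤ R * ((α - β) * τ * ‖w‖) :=
        mul_le_mul (hR t ht.le) hr (norm_nonneg _) ((norm_nonneg _).trans (hR t ht.le))
      linarith
    have hKs : K / (2 * p - 2) * (-(2 * p - 2) * (t * τ ^ 2)) = -(K * (t * τ ^ 2)) := by
      have : 2 * p - 2 ≠ 0 := by linarith
      rw [neg_mul, mul_neg, ← mul_assoc, div_mul_cancel₀ _ this]
    rw [hKs, real_inner_self_eq_norm_sq]
    have k1 := mul_le_mul_of_nonneg_left hyg (by positivity : 0 ≤ 2 * t)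
    have k3 := mul_le_mul_of_nonneg_left hyr (by positivity : 0 ≤ 2 * t)
    have k5 := mul_le_mul_of_nonneg_left (hK ‖w‖ τ) ht0.le
    nlinarith

end IsTrajectory

/-! ### Asymptotics: velocity bound, optimality, convergence -/

theorem exists_young_constant {ε : ℝ} (hε : 0 < ε) (c : ℝ) :
    ∃ K, 0 ≤ K ∧ ∀ V τ : ℝ, c * (τ * V) ≤ ε / 2 * V ^ 2 + K * τ ^ 2 := by
  refine ⟨c ^ 2 / (2 * ε), by positivity, fun V τ => ?_⟩
  have h : ε / 2 * V ^ 2 + c ^ 2 / (2 * ε) * τ ^ 2 - c * (τ * V)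
      = (ε * V - c * τ) ^ 2 / (2 * ε) := by
    field_simp
    ring
  have h2 : 0 ≤ (ε * V - c * τ) ^ 2 / (2 * ε) := by positivity
  linarith

theorem continuous_minGap [Nonempty (Fin m)] (hf : ∀ i, Continuous (f i))
    (z : EuclideanSpace ℝ (Fin n)) : Continuous (minGap f z) :=
  Continuous.finset_inf'_apply _ fun i _ => (hf i).sub continuous_const

theorem minGap_self [Nonempty (Fin m)] (z : EuclideanSpace ℝ (Fin n)) : minGap f z z = 0 := by
  simp [minGap]

theorem le_energy [Nonempty (Fin m)] (f : Fin m → EuclideanSpace ℝ (Fin n) → ℝ)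
    (x v : ℝ → EuclideanSpace ℝ (Fin n)) (hβ : 3 < β) (hαβ : β < α) (hp : 1 < p)
    (ht₀ : 1 ≤ t₀) {K : ℝ} (hK : 0 ≤ K) (z : EuclideanSpace ℝ (Fin n)) {t : ℝ} (ht : t₀ ≤ t) :
    t ^ 2 * minGap f z (x t) + 1 / 2 * ‖(2 : ℝ) • (x t - z) + t • v t‖ ^ 2
      + (β - 3) / 2 * kineticIntegral t₀ v t ≤ energy f α β p t₀ K x v z t := by
  have h1 : 0 ≤ (α - 3) * ‖x t - z‖ ^ 2 := mul_nonneg (by linarith) (sq_nonneg _)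
  have h2 : 0 ≤ K / (2 * p - 2) * t ^ (2 - 2 * p) :=
    mul_nonneg (div_nonneg hK (by linarith)) (Real.rpow_nonneg (by linarith) _)
  rw [energy]
  linarith

namespace IsTrajectory

/-- The objective values of a bounded trajectory converge to limits that they undercut by at most
the kinetic energy. -/
theorem exists_tendsto_objective (hx : IsTrajectory f α β p t₀ x v)
    (hbdd : ∀ i, BddBelow (range (f i))) (hC1 : ∀ i, ContDiff ℝ 1 (f i)) (hβ : 3 < β)
    (hαβ : β < α) (hp : 1 < p) (ht₀ : 1 ≤ t₀) {D : ℝ}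
    (hD : ∀ t, t₀ ≤ t → t ^ 2 * ‖v t‖ ^ 2 ≤ D) (i : Fin m) :
    ∃ l, Tendsto (fun t => f i (x t)) atTop (𝓝 l) ∧
      ∀ t, t₀ ≤ t → -(1 / 2 * ‖v t‖ ^ 2) ≤ f i (x t) - l := by
  obtain ⟨b, hb⟩ := hbdd i
  obtain ⟨l, hl, hle⟩ := exists_tendsto_of_antitoneOn
    (hx.antitoneOn_objective hC1 (by linarith) hαβ hp ht₀ i) (C := b) fun t ht => by
      have := hb (mem_range_self (x t))
      have h2 : 0 ≤ 1 / 2 * ‖v t‖ ^ 2 := by positivity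
      linarith
  have hv : Tendsto (fun t => 1 / 2 * ‖v t‖ ^ 2) atTop (𝓝 0) := by
    have h0 : Tendsto (fun t : ℝ => 1 / 2 * D / t ^ 2) atTop (𝓝 0) :=
      (tendsto_pow_atTop two_ne_zero).const_div_atTop _
    refine squeeze_zero' (Eventually.of_forall fun t => by positivity) ?_ h0
    filter_upwards [eventually_ge_atTop t₀] with t ht
    have ht0 : 0 < t := by linarith
    rw [le_div_iff₀ (by positivity)]
    linarith [hD t ht]
  refine ⟨l, by simpa using hl.sub hv, fun t ht => ?_⟩
  have := hle t ht
  linarith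

variable [Nonempty (Fin m)]

/-- The velocity of a bounded trajectory is `O(1 / t)`. -/
theorem exists_mul_norm_velocity_sq_le (hx : IsTrajectory f α β p t₀ x v)
    (hbdd : ∀ i, BddBelow (range (f i)))
    (hconv : ∀ i, ConvexOn ℝ univ (f i)) (hC1 : ∀ i, ContDiff ℝ 1 (f i)) (hβ : 3 < β)
    (hαβ : β < α) (hp : 1 < p) (ht₀ : 1 ≤ t₀) {R : ℝ} (hR : ∀ t, t₀ ≤ t → ‖x t‖ ≤ R) :
    ∃ D, ∀ t, t₀ ≤ t → t ^ 2 * ‖v t‖ ^ 2 ≤ D := by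
  obtain ⟨K, hK0, hK⟩ := exists_young_constant (sub_pos.2 hβ) (2 * (R + R) * (α - β))
  obtain ⟨j⟩ := ‹Nonempty (Fin m)›
  have : Nonempty (Fin m) := ⟨j⟩
  obtain ⟨b, hb⟩ := hbdd j
  have hRR : ∀ s, t₀ ≤ s → ∀ t, t₀ ≤ t → ‖x t - x s‖ ≤ R + R := fun s hs t ht =>
    (norm_sub_le _ _).trans (add_le_add (hR t ht) (hR s hs))
  -- Twice a bound for the energy at `t₀`, uniform over all reference points on the trajectory.
  refine ⟨2 * (t₀ ^ 2 * (f j (x t₀) - b) + 1 / 2 * (2 * (R + R) + t₀ * ‖v t₀‖) ^ 2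
    + (α - 3) * (R + R) ^ 2 + K / (2 * p - 2) * t₀ ^ (2 - 2 * p)), fun t ht => ?_⟩
  -- The reference point is the current position `x t`: at time `t` the gap and the displacement
  -- vanish and `t ^ 2 ‖v t‖ ^ 2 / 2` remains.
  have h1 := hx.antitoneOn_energy hconv hC1 hαβ hp ht₀ hK (hRR t ht) (mem_Ici.2 le_rfl) ht ht
  have h2 := le_energy f x v hβ hαβ hp ht₀ hK0 (x t) ht
  have h3 : 0 ≤ (β - 3) / 2 * kineticIntegral t₀ v t :=
    mul_nonneg (by linarith) (hx.kineticIntegral_nonneg (by linarith) ht)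
  simp only [minGap_self, sub_self, smul_zero, zero_add, norm_smul, mul_zero] at h2
  rw [mul_pow, Real.norm_eq_abs, sq_abs] at h2
  have h4 : energy f α β p t₀ K x v (x t) t₀ ≤ t₀ ^ 2 * (f j (x t₀) - b)
      + 1 / 2 * (2 * (R + R) + t₀ * ‖v t₀‖) ^ 2
      + (α - 3) * (R + R) ^ 2 + K / (2 * p - 2) * t₀ ^ (2 - 2 * p) := by
    have hd := hRR t ht t₀ le_rfl
    have hI : kineticIntegral t₀ v t₀ = 0 := by simp [kineticIntegral]
    have hm : minGap f (x t) (x t₀) ≤ f j (x t₀) - b :=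
      (minGap_le _ _ j).trans (sub_le_sub_left (hb (mem_range_self _)) _)
    have hn : ‖(2 : ℝ) • (x t₀ - x t) + t₀ • v t₀‖ ≤ 2 * (R + R) + t₀ * ‖v t₀‖ := by
      refine (norm_add_le _ _).trans ?_
      rw [norm_smul, norm_smul, Real.norm_of_nonneg (by linarith : 0 ≤ t₀), Real.norm_two]
      linarith
    rw [energy, hI, mul_zero, add_zero]
    have hα : 0 ≤ α - 3 := by linarith
    gcongr
  linarith

theorem isWeakPareto_of_tendsto (hx : IsTrajectory f α β p t₀ x v)
    (hconv : ∀ i, ConvexOn ℝ univ (f i)) (hC1 : ∀ i, ContDiff ℝ 1 (f i)) (hβ : 3 < β)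
    (hαβ : β < α) (hp : 1 < p) (ht₀ : 1 ≤ t₀) {R : ℝ} (hR : ∀ t, t₀ ≤ t → ‖x t‖ ≤ R)
    {y : EuclideanSpace ℝ (Fin n)} (hy : Tendsto x atTop (𝓝 y)) : IsWeakPareto f y := by
  rintro ⟨z, hz⟩
  obtain ⟨K, hK0, hK⟩ := exists_young_constant (sub_pos.2 hβ) (2 * (R + ‖z‖) * (α - β))
  have hpos : 0 < minGap f z y := by
    rw [minGap, Finset.lt_inf'_iff]
    exact fun i _ => sub_pos.2 (hz i)
  have hlim := ((continuous_minGap (fun i => (hC1 i).continuous) z).tendsto y).comp hy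
  have htop : Tendsto (fun t : ℝ => t ^ 2 * minGap f z (x t)) atTop atTop :=
    (tendsto_pow_atTop two_ne_zero).atTop_mul_pos hpos hlim
  obtain ⟨t, h1, ht⟩ := ((htop.eventually_gt_atTop (energy f α β p t₀ K x v z t₀)).and
    (eventually_ge_atTop t₀)).exists
  have h2 := hx.antitoneOn_energy hconv hC1 hαβ hp ht₀ hK
    (fun s hs => (norm_sub_le _ _).trans (add_le_add_left (hR s hs) _)) (mem_Ici.2 le_rfl) ht ht
  have h3 := le_energy f x v hβ hαβ hp ht₀ hK0 z ht
  have h4 : 0 ≤ (β - 3) / 2 * kineticIntegral t₀ v t :=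
    mul_nonneg (by linarith) (hx.kineticIntegral_nonneg (by linarith) ht)
  have h5 : 0 ≤ 1 / 2 * ‖(2 : ℝ) • (x t - z) + t • v t‖ ^ 2 := by positivity
  linarith

/-- The distance of the trajectory to a point that is eventually not worse, up to the kinetic
energy, in all objectives converges. -/
theorem exists_tendsto_norm_sub_sq (hx : IsTrajectory f α β p t₀ x v)
    (hconv : ∀ i, ConvexOn ℝ univ (f i)) (hC1 : ∀ i, ContDiff ℝ 1 (f i)) (hβ : 3 < β)
    (hαβ : β < α) (hp : 1 < p) (ht₀ : 1 ≤ t₀) {R D : ℝ} (hR : ∀ t, t₀ ≤ t → ‖x t‖ ≤ R)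
    (hD : ∀ t, t₀ ≤ t → t ^ 2 * ‖v t‖ ^ 2 ≤ D) {z : EuclideanSpace ℝ (Fin n)}
    (hz : ∀ i t, t₀ ≤ t → -(1 / 2 * ‖v t‖ ^ 2) ≤ f i (x t) - f i z) :
    ∃ l, Tendsto (fun t => ‖x t - z‖ ^ 2) atTop (𝓝 l) := by
  obtain ⟨K, hK0, hK⟩ := exists_young_constant (sub_pos.2 hβ) (2 * (R + ‖z‖) * (α - β))
  have hRz : ∀ t, t₀ ≤ t → ‖x t - z‖ ≤ R + ‖z‖ := fun s hs =>
    (norm_sub_le _ _).trans (add_le_add_left (hR s hs) _)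
  -- The gap may be negative, but `hz` and `hD` give `t ^ 2 * minGap ≥ -D / 2`.
  set M := energy f α β p t₀ K x v z t₀ + 1 / 2 * D with hM
  have hI : ∀ t, t₀ ≤ t → (β - 3) / 2 * kineticIntegral t₀ v t ≤ M := fun t ht => by
    have h1 := hx.antitoneOn_energy hconv hC1 hαβ hp ht₀ hK hRz (mem_Ici.2 le_rfl) ht ht
    have h2 := le_energy f x v hβ hαβ hp ht₀ hK0 z ht
    have h3 : -(1 / 2 * ‖v t‖ ^ 2) ≤ minGap f z (x t) :=
      Finset.le_inf' _ _ fun i _ => hz i t ht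
    have h4 := mul_le_mul_of_nonneg_left h3 (sq_nonneg t)
    have h5 : 0 ≤ 1 / 2 * ‖(2 : ℝ) • (x t - z) + t • v t‖ ^ 2 := by positivity
    rw [hM]
    linarith [hD t ht]
  have hI' : ∀ t, t₀ ≤ t → kineticIntegral t₀ v t ≤ M / ((β - 3) / 2) := fun t ht => by
    rw [le_div_iff₀ (by linarith), mul_comm]
    exact hI t ht
  obtain ⟨lI, hlI, -⟩ := exists_tendsto_of_antitoneOn (φ := fun t => -kineticIntegral t₀ v t)
    (hx.monotoneOn_kineticIntegral (by linarith)).neg (fun t ht => neg_le_neg (hI' t ht))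
  have hanti := hx.antitoneOn_anchor hconv hC1 hp ht₀ hK hRz hz
  have hlow : ∀ t, t₀ ≤ t → -((R + ‖z‖) ^ 2 + D) - (3 + (β - 3) / 2) * (M / ((β - 3) / 2)) ≤
      t * (2 * inner ℝ (x t - z) (v t)) + (α - 1) * ‖x t - z‖ ^ 2
      - (3 + (β - 3) / 2) * kineticIntegral t₀ v t + K / (2 * p - 2) * t ^ (2 - 2 * p) := by
    intro t ht
    have ht0 : 0 ≤ t := by linarith
    have h1 : 0 ≤ (α - 1) * ‖x t - z‖ ^ 2 := mul_nonneg (by linarith) (sq_nonneg _)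
    have h2 : 0 ≤ K / (2 * p - 2) * t ^ (2 - 2 * p) :=
      mul_nonneg (div_nonneg hK0 (by linarith)) (Real.rpow_nonneg ht0 _)
    have h3 := mul_le_mul_of_nonneg_left (hI' t ht) (by linarith : 0 ≤ 3 + (β - 3) / 2)
    have h4 := neg_le_of_abs_le (abs_real_inner_le_norm (x t - z) (v t))
    have h5 : ‖x t - z‖ ^ 2 ≤ (R + ‖z‖) ^ 2 := by
      have := hRz t ht
      gcongr
    have h6 := mul_le_mul_of_nonneg_left h4 ht0
    -- `2 ‖x - z‖ (t ‖v‖) ≤ ‖x - z‖ ^ 2 + t ^ 2 ‖v‖ ^ 2`.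
    nlinarith [hD t ht, sq_nonneg (‖x t - z‖ - t * ‖v t‖)]
  obtain ⟨l, hl, -⟩ := exists_tendsto_of_antitoneOn hanti hlow
  have htail : Tendsto (fun t : ℝ => K / (2 * p - 2) * t ^ (2 - 2 * p)) atTop (𝓝 0) := by
    have h := (tendsto_rpow_neg_atTop (by linarith : 0 < 2 * p - 2)).const_mul (K / (2 * p - 2))
    simpa using h
  -- Removing the tail and restoring the kinetic integral, whose negative tends to `lI`, leaves `t
  -- h' + (α - 1) h` for `h = ‖x - z‖ ^ 2`.
  have hsum := (hl.sub htail).sub (hlI.const_mul (3 + (β - 3) / 2))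
  refine ⟨_, tendsto_of_tendsto_mul_deriv_add (κ := α - 1) (by linarith)
    (fun t ht => ((hx.hasDerivAt ht).sub_const z).norm_sq) (hsum.congr fun t => ?_)⟩
  ring

theorem exists_tendsto (hx : IsTrajectory f α β p t₀ x v)
    (hbdd : ∀ i, BddBelow (range (f i)))
    (hconv : ∀ i, ConvexOn ℝ univ (f i)) (hC1 : ∀ i, ContDiff ℝ 1 (f i)) (hβ : 3 < β)
    (hαβ : β < α) (hp : 1 < p) (ht₀ : 1 ≤ t₀) {R : ℝ} (hR : ∀ t, t₀ ≤ t → ‖x t‖ ≤ R) :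
    ∃ y, Tendsto x atTop (𝓝 y) := by
  obtain ⟨D, hD⟩ := hx.exists_mul_norm_velocity_sq_le hbdd hconv hC1 hβ hαβ hp ht₀ hR
  choose l hl hle using hx.exists_tendsto_objective hbdd hC1 hβ hαβ hp ht₀ hD
  have hmem : ∀ k : ℕ, x (t₀ + k) ∈ Metric.closedBall (0 : EuclideanSpace ℝ (Fin n)) R := fun k =>
    mem_closedBall_zero_iff.2 (hR _ (by simp))
  obtain ⟨y, -, σ, hσ, hy⟩ := (isCompact_closedBall _ R).tendsto_subseq hmem
  have htop : Tendsto (fun k : ℕ => t₀ + (σ k : ℝ)) atTop atTop :=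
    tendsto_atTop_add_const_left _ _ (tendsto_natCast_atTop_atTop.comp hσ.tendsto_atTop)
  have hfy : ∀ i, f i y = l i := fun i =>
    tendsto_nhds_unique (((hC1 i).continuous.tendsto y).comp hy) ((hl i).comp htop)
  -- The cluster point `y` attains all the limit values `l i`, so it is admissible as an anchor.
  obtain ⟨d, hd⟩ := hx.exists_tendsto_norm_sub_sq hconv hC1 hβ hαβ hp ht₀ hR hD (z := y)
    fun i t ht => by rw [hfy]; exact hle i t ht
  have hd0 : d = 0 := by
    have h1 : Tendsto (fun k => ‖x (t₀ + (σ k : ℝ)) - y‖ ^ 2) atTop (𝓝 0) := by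
      have := ((tendsto_iff_norm_sub_tendsto_zero.1 hy).pow 2)
      simpa using this
    exact tendsto_nhds_unique (hd.comp htop) h1
  refine ⟨y, tendsto_iff_norm_sub_tendsto_zero.2 ?_⟩
  have := hd.sqrt
  simpa [hd0, Real.sqrt_sq (norm_nonneg _)] using this

end IsTrajectory

end MultiobjFlow

theorem mainTheorem3 (n m : ℕ) (f : Fin m → EuclideanSpace ℝ (Fin n) → ℝ)
    (hbdd : ∀ i, BddBelow (range (f i)))
    (hconv : ∀ i, ConvexOn ℝ univ (f i))
    (hC1 : ∀ i, ContDiff ℝ 1 (f i))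
    (hLip : ∃ L : NNReal, ∀ i, LipschitzWith L (gradient (f i)))
    (hlevel : ∃ j, ∀ c : ℝ, Bornology.IsBounded {z | f j z ≤ c})
    (α β p t₀ : ℝ) (hβ : 3 < β) (hαβ : β < α) (hp : 1 < p) (ht₀ : 1 ≤ t₀)
    (x₀ v₀ : EuclideanSpace ℝ (Fin n)) (x : ℝ → EuclideanSpace ℝ (Fin n))
    (hx : MultiobjFlow.IsSolution f α β p t₀ x₀ v₀ x)
    (hxbdd : Bornology.IsBounded (x '' Ici t₀)) :
    ∃ xinf, MultiobjFlow.IsWeakPareto f xinf ∧ Tendsto x atTop (𝓝 xinf) := by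
  have : Nonempty (Fin m) := ⟨hlevel.choose⟩
  obtain ⟨v, hv⟩ := hx.exists_isTrajectory (by linarith) hαβ.le (by linarith)
  obtain ⟨R, hR⟩ := hxbdd.exists_norm_le
  have hR' : ∀ t, t₀ ≤ t → ‖x t‖ ≤ R := fun t ht => hR _ (mem_image_of_mem x ht)
  obtain ⟨y, hy⟩ := hv.exists_tendsto hbdd hconv hC1 hβ hαβ hp ht₀ hR'
  exact ⟨y, hv.isWeakPareto_of_tendsto hconv hC1 hβ hαβ hp ht₀ hR' hy, hy⟩
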